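/- Let $I$ be a finite or countably infinite set and let $(A,\Psi)$ be a Borcherds--Kac--Moody (BKM) supermatrix: $A=(a_{ij})_{i,j\in I}$ is a real matrix and $\Psi\subseteq I$ is a subset (the odd indices) such that, for all $i,j\in I$, (1) $a_{ii}=2$ or $a_{ii}\le 0$; (2) $a_{ij}\le 0$ if $i\ne j$; (3) $a_{ij}=0$ if and only if $a_{ji}=0$; (4) $a_{ij}\in\mathbb Z$ if $a_{ii}=2$; (5) $a_{ij}\in 2\mathbb Z$ if $a_{ii}=2$ and $i\in\Psi$; (6) there are $d_i>0$ with $d_ia_{ij}=d_ja_{ji}$. Put $I^{\mathrm{re}}=\{i: a_{ii}=2\}$, $I^{\mathrm{im}}=I\setminus I^{\mathrm{re}}$, $\Psi_0=\{i\in\Psi: a_{ii}=0\}$. Let $\mathfrak h$ be the complex vector space with basis $\{h_i, D_i: i\in I\}$ (the Cartan subalgebra, extended by the degree derivations), let $\alpha_j\in\mathfrak h^*$ be the simple roots, $\alpha_j(h_i)=a_{ij}$, $\alpha_j(D_i)=\delta_{ij}$, and put $(\lambda,\alpha_i)=d_i\lambda(h_i)$ for $\lambda\in\mathfrak h^*$.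 Let $W\le \mathrm{GL}(\mathfrak h^*)$ be the Weyl group, generated by the reflections $s_i(\lambda)=\lambda-2\frac{(\lambda,\alpha_i)}{(\alpha_i,\alpha_i)}\alpha_i$, $i\in I^{\mathrm{re}}$, with length function $\ell$, and let $\rho\in\mathfrak h^*$ be any element with $2(\rho,\alpha_i)=(\alpha_i,\alpha_i)$ for all $i\in I$. For a finitely supported $\mathbf k=(k_i)_{i\in I}\in\mathbb Z_+[I]$ put $\eta(\mathbf k)=\sum_i k_i\alpha_i$ and $\mathrm{ht}(\eta(\mathbf k))=\sum_i k_i$. Let $\Omega$ be the set of all $\gamma=\sum_i m_i\alpha_i$ with $(m_i)_{i\in I}\in\mathbb Z_+[I]$ such that $m_i=0$ for $i\in I^{\mathrm{re}}$; $m_i\le 1$ for $i\notin\Psi$; $(\alpha_i,\alpha_j)=0$ whenever $i\neq j$ and $m_i,m_j\ne 0$; and $(\alpha_i,\alpha_i)=0$ whenever $i\in\Psi$ and $m_i\ge 2$. Let $$U=\sum_{w\in W}\sum_{\gamma\in\Omega}(-1)^{\ell(w)}(-1)^{\mathrm{ht}(\gamma)}\,e^{w(\rho-\gamma)-\rho}$$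 be the sum side of the denominator identity. Every exponent $w(\rho-\gamma)-\rho$ is of the form $-\eta(\beta)$ with $\beta\in\mathbb Z_+[I]$, each such exponent occurs for only finitely many pairs $(w,\gamma)$, and $U$, regarded as an element of $\mathbb C[[e^{-\alpha_i}: i\in I]]$, is invertible. Let $G$ be the quasi Dynkin diagram of $(A,\Psi)$, i.e. the simple graph with vertex set $I$ in which distinct $i,j$ are adjacent if and only if $a_{ij}\neq 0$. Let $\mathbf k\in\mathbb Z_+[I]$ be free, i.e. $k_i\le 1$ for all $i\in I^{\mathrm{re}}\sqcup\Psi_0$. Then the number of maps $\tau$ from $I$ to the subsets of $\{1,\dots,q\}$ with $|\tau(i)|=k_i$ for all $i$ and $\tau(i)\cap\tau(j)=\emptyset$ for all adjacent $i,j$ is, as a function of $q\in\mathbb Z_{\ge 0}$, given by a (unique) polynomial $\pi^G_{\mathbf k}(q)$, the $\mathbf k$-chromatic polynomial of $G$, and for every $q\in\mathbb Z$ the coefficient of $e^{-\eta(\mathbf k)}$ in $U^q$ is $$U^q[e^{-\eta(\mathbf k)}]=(-1)^{\mathrm{ht}(\eta(\mathbf k))}\,\pi^G_{\mathbf k}(q).$$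 -/

import Mathlib

open Polynomial

noncomputable section

/-- A Borcherds-Kac-Moody supermatrix `(A, Ψ)` indexed by `I`, together with a chosen
symmetrizer `d` (the positive diagonal matrix that makes `A` symmetrizable).
The defining conditions force all entries to be real. -/
structure BKMSupermatrix (I : Type*) where
  A : Matrix I I ℝ
  /-- the set `Ψ` of odd indices -/
  odd : Set I
  /-- the diagonal entries of the symmetrizing matrix -/
  d : I → ℝ
  diag : ∀ i, A i i = 2 ∨ A i i ≤ 0
  off_diag : ∀ i j, i ≠ j → A i j ≤ 0
  zero_iff : ∀ i j, A i j = 0 ↔ A j i = 0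
  integral : ∀ i j, A i i = 2 → ∃ m : ℤ, A i j = m
  even_integral : ∀ i j, A i i = 2 → i ∈ odd → ∃ m : ℤ, A i j = 2 * m
  d_pos : ∀ i, 0 < d i
  symm : ∀ i j, d i * A i j = d j * A j i

/-- The Cartan subalgebra `𝔥 ⊕ D`, with basis the `h_i` and the degree derivations `D_i`
(which make the simple roots linearly independent). -/
abbrev ExtCartan (I : Type*) : Type _ := (I →₀ ℂ) × (I →₀ ℂ)

/-- The space of weights, i.e. the full dual space of the Cartan subalgebra. -/
abbrev WeightSpace (I : Type*) : Type _ := Module.Dual ℂ (ExtCartan I)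

namespace BKMSupermatrix

variable {I : Type*}

/-- The basis element `h_i` of the Cartan subalgebra. -/
def coroot (i : I) : ExtCartan I := (Finsupp.single i 1, 0)

/-- The basis element `D_i` of the Cartan subalgebra. -/
def derivation (i : I) : ExtCartan I := (0, Finsupp.single i 1)

variable (M : BKMSupermatrix I)

/-- The simple root `α_j`, with `α_j(h_i) = a_{ij}` and `α_j(D_i) = δ_{ij}`. -/
def simpleRoot (j : I) : WeightSpace I :=
  LinearMap.coprod (Finsupp.linearCombination ℂ (fun i => (M.A i j : ℂ))) (Finsupp.lapply j)

theorem simpleRoot_coroot (i j : I) : M.simpleRoot j (coroot i) = (M.A i j : ℂ) := by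
  simp [simpleRoot, coroot]

theorem simpleRoot_derivation [DecidableEq I] (i j : I) :
    M.simpleRoot j (derivation i) = if i = j then 1 else 0 := by
  simp [simpleRoot, derivation, Finsupp.single_apply]

/-- The functional `λ ↦ (λ, α_i) = d_i λ(h_i)`; in particular
`(α_j, α_i) = d_i a_{ij} = (α_i, α_j)`. -/
def form (i : I) : Module.Dual ℂ (WeightSpace I) :=
  (M.d i : ℂ) • Module.Dual.eval ℂ (ExtCartan I) (coroot i)

theorem form_apply (i : I) (μ : WeightSpace I) : M.form i μ = (M.d i : ℂ) * μ (coroot i) := by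
  simp [form]

theorem form_simpleRoot (i j : I) :
    M.form i (M.simpleRoot j) = (M.d i : ℂ) * (M.A i j : ℂ) := by
  rw [form_apply, simpleRoot_coroot]

/-- The index set `I^re` of real simple roots. -/
def realIdx : Set I := {i | M.A i i = 2}

/-- The set `Ψ₀` of odd indices with vanishing diagonal entry. -/
def oddNull : Set I := {i | i ∈ M.odd ∧ M.A i i = 0}

/-- The functional `λ ↦ 2 (λ, α_i) / (α_i, α_i)`. -/
def reflFunctional (i : I) : Module.Dual ℂ (WeightSpace I) :=
  (2 / M.form i (M.simpleRoot i)) • M.form i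

theorem reflFunctional_simpleRoot (i : M.realIdx) :
    M.reflFunctional i (M.simpleRoot i) = 2 := by
  have hA : M.A i i = 2 := i.2
  have hd : (M.d i : ℂ) ≠ 0 := by exact_mod_cast (M.d_pos i).ne'
  have h : M.form i (M.simpleRoot i) ≠ 0 := by
    rw [form_simpleRoot, hA]
    simp [hd]
  simp [reflFunctional, div_mul_cancel₀ _ h]

/-- The simple reflection `s_i(λ) = λ - 2 (λ, α_i) / (α_i, α_i) α_i` of a real simple root. -/
def simpleReflection (i : M.realIdx) : WeightSpace I ≃ₗ[ℂ] WeightSpace I :=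
  Module.reflection (M.reflFunctional_simpleRoot i)

theorem simpleReflection_apply (i : M.realIdx) (μ : WeightSpace I) :
    M.simpleReflection i μ =
      μ - (2 * M.form i μ / M.form i (M.simpleRoot i)) • M.simpleRoot i := by
  simp [simpleReflection, Module.reflection_apply, reflFunctional, div_mul_eq_mul_div]

/-- The Weyl group, generated by the simple reflections of the real simple roots. -/
def weylGroup : Subgroup (WeightSpace I ≃ₗ[ℂ] WeightSpace I) :=
  Subgroup.closure (Set.range M.simpleReflection)

/-- The length of a Weyl group element: the least number of simple reflections in a product
that equals it. -/
def length (w : M.weylGroup) : ℕ :=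
  sInf {n | ∃ l : List M.realIdx, l.length = n ∧
    (l.map M.simpleReflection).prod = (w : WeightSpace I ≃ₗ[ℂ] WeightSpace I)}

/-- The height of an element `∑ k_i α_i` of `Q₊`, given by its coefficients. -/
def height (k : I →₀ ℕ) : ℕ := k.sum fun _ n => n

/-- The element `η(k) = ∑ k_i α_i` of `Q₊`. -/
def eta (k : I →₀ ℕ) : WeightSpace I := k.sum fun i n => n • M.simpleRoot i

/-- The set `Ω` of all `γ = ∑ α_{i_j} + ∑ l_{i_k} β_{i_k}`, where the `α_{i_j}` are distinct even
and the `β_{i_k}` distinct odd imaginary simple roots, these simple roots are pairwise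
orthogonal, and `(β_{i_k}, β_{i_k}) = 0` whenever `l_{i_k} ≥ 2`.
Elements are given by their coefficients. -/
def Omega : Set (I →₀ ℕ) :=
  {γ | (∀ i, γ i ≠ 0 → i ∉ M.realIdx) ∧
    (∀ i, i ∉ M.odd → γ i ≤ 1) ∧
    (∀ i j, i ≠ j → γ i ≠ 0 → γ j ≠ 0 → M.form i (M.simpleRoot j) = 0) ∧
    (∀ i, i ∈ M.odd → 2 ≤ γ i → M.form i (M.simpleRoot i) = 0)}

/-- The condition `2 (ρ, α_i) = (α_i, α_i)` for all `i`. -/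
def IsWeylVector (ρ : WeightSpace I) : Prop :=
  ∀ i, 2 * M.form i ρ = M.form i (M.simpleRoot i)

/-- The pairs `(w, γ)` whose term in the sum is a multiple of `e^{-η(β)}`,
i.e. `w(ρ - γ) - ρ = -η(β)`. -/
def termsAt (ρ : WeightSpace I) (β : I →₀ ℕ) : Set (M.weylGroup × M.Omega) :=
  {p | (p.1 : WeightSpace I ≃ₗ[ℂ] WeightSpace I) (ρ - M.eta p.2) - ρ = -M.eta β}

/-- The sum side `U = ∑_{w ∈ W} ∑_{γ ∈ Ω} ε(w) ε(γ) e^{w(ρ - γ) - ρ}` of the denominator identity,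
as a formal power series in the variables `X_i = e^{-α_i}`: the coefficient of
`X^β = e^{-η(β)}` is the sum of the signs over all terms with that exponent. -/
def U (ρ : WeightSpace I) : MvPowerSeries I ℂ := fun β =>
  ∑ᶠ p ∈ M.termsAt ρ β, (-1 : ℂ) ^ M.length p.1 * (-1 : ℂ) ^ height (p.2 : I →₀ ℕ)

/-- The (underlying graph of the) quasi Dynkin diagram. -/
def quasiDynkin : SimpleGraph I where
  Adj i j := i ≠ j ∧ M.A i j ≠ 0
  symm := ⟨fun i j h => ⟨h.1.symm, fun h' => h.2 ((M.zero_iff i j).2 h')⟩⟩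
  loopless := ⟨fun _ h => h.1 rfl⟩

/-- `k` is free: `k_i ≤ 1` for `i ∈ I^re ⊔ Ψ₀`. -/
def IsFree (k : I →₀ ℕ) : Prop := ∀ i ∈ M.realIdx ∪ M.oddNull, k i ≤ 1

end BKMSupermatrix

/-- The proper vertex `k`-multicolorings of `G` with `q` colors. -/
def Multicoloring {I : Type*} (G : SimpleGraph I) (k : I →₀ ℕ) (q : ℕ) : Type _ :=
  {τ : I → Finset (Fin q) //
    (∀ i, (τ i).card = k i) ∧ ∀ i j, G.Adj i j → Disjoint (τ i) (τ j)}

/-- `P` is the `k`-chromatic polynomial of `G`: its value at every `q ∈ ℕ` is the number of proper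
vertex `k`-multicolorings with `q` colors. (These values determine `P`.) -/
def IsChromaticPolynomial {I : Type*} (G : SimpleGraph I) (k : I →₀ ℕ) (P : ℚ[X]) : Prop :=
  ∀ q : ℕ, P.eval (q : ℚ) = (Nat.card (Multicoloring G k q) : ℚ)

end

/-! In free degrees, `U` is the signed independence series of the quasi Dynkin diagram: its
coefficient at `β` is `(-1)^height β` if `β` is the indicator of an independent set, and `0`
otherwise (`IsWeylVector.coeff_U`). A coefficient of `U ^ q` with `q` natural then counts the ways
to write `k` as an ordered sum of `q` such indicators. These are the color classes of a proper
multicoloring, and the sign depends only on `k`.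

The computation of `U` rests on Weyl group theory. For `γ ∈ Ω` the weight `ρ - γ` is positive and
integral on the real coroots, because `γ` involves only imaginary roots. As in the theory of Coxeter
groups, `w α_i` is a nonnegative combination of simple roots unless `w s_i` is shorter than `w`
(`apply_simpleRoot_nonneg_or`, by reduction to rank two). Hence `w (ρ - γ) = ρ - γ - η(c)` with `c ≥
0`, and `c = 0` only for `w = 1`, so every exponent comes from at most one pair `(w, γ)`. If `c` has
all coefficients at most `1`, then `w` is a product of pairwise orthogonal simple reflections, each
subtracting its root exactly once (`IsRegularDominant.exists_orthogonal_word`). The roots subtracted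
and those in `γ` then form an independent set, and conversely every independent set arises by
splitting it into its real and imaginary vertices.

For integral `q`, the constant term of `U` is `1`, so the binomial series in `U - 1` makes each
coefficient of `U ^ q` a single polynomial in `q`. Up to sign it takes the values of the
multicoloring count at all natural numbers, so it gives the chromatic polynomial and settles
negative `q` as well. -/

namespace BKMSupermatrix

variable {I : Type*} (M : BKMSupermatrix I)

/-! ### Elements of the root lattice -/

theorem eta_add (b c : I →₀ ℕ) : M.eta (b + c) = M.eta b + M.eta c :=
  Finsupp.sum_add_index' (by simp) (by simp [add_smul])

theorem eta_zero : M.eta 0 = 0 := Finsupp.sum_zero_index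

theorem eta_nsmul (n : ℕ) (c : I →₀ ℕ) : M.eta (n • c) = n • M.eta c := by
  induction n with
  | zero => simp [eta_zero]
  | succ n ih => rw [succ_nsmul, eta_add, ih, succ_nsmul]

theorem eta_single (i : I) (n : ℕ) : M.eta (Finsupp.single i n) = n • M.simpleRoot i := by
  simp [eta]

theorem simpleRoot_derivation_self (i : I) : M.simpleRoot i (derivation i) = 1 := by
  classical simp [simpleRoot_derivation]

theorem simpleRoot_derivation_of_ne {i j : I} (h : i ≠ j) :
    M.simpleRoot j (derivation i) = 0 := by
  classical simp [simpleRoot_derivation, h]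

theorem eta_derivation (c : I →₀ ℕ) (i : I) : M.eta c (derivation i) = c i := by
  classical
  induction c using Finsupp.induction_linear with
  | zero => simp [eta_zero]
  | add b c hb hc => simp [eta_add, hb, hc]
  | single j n => simp [eta_single, simpleRoot_derivation, Finsupp.single_apply, eq_comm]

/-- Evaluation at the derivations `D_i` reads off the coefficients. The roots `α_j` restricted to
the span of the `h_i` alone may be linearly dependent. -/
theorem eta_injective : Function.Injective M.eta := fun b c h => by
  ext i
  have := congrArg (fun μ => μ (derivation i)) h
  simpa [eta_derivation] using this

theorem eta_coroot (c : I →₀ ℕ) (i : I) :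
    M.eta c (coroot i) = c.sum fun j n => (n : ℂ) * M.A i j := by
  simp [eta, Finsupp.sum, LinearMap.sum_apply, simpleRoot_coroot]

/-! ### Simple reflections and words -/

variable {M}

theorem simpleReflection_eq (i : M.realIdx) (μ : WeightSpace I) :
    M.simpleReflection i μ = μ - μ (coroot (i : I)) • M.simpleRoot i := by
  have hA : M.A i i = 2 := i.2
  have hd : (M.d i : ℂ) ≠ 0 := by exact_mod_cast (M.d_pos i).ne'
  rw [simpleReflection_apply, form_apply, form_simpleRoot, hA]
  congr 2
  push_cast
  field_simp

theorem simpleReflection_involutive (i : M.realIdx) (μ : WeightSpace I) :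
    M.simpleReflection i (M.simpleReflection i μ) = μ :=
  Module.involutive_reflection (M.reflFunctional_simpleRoot i) μ

variable (M) in
/-- A simple reflection as an element of the Weyl group. -/
noncomputable def weylReflection (i : M.realIdx) : M.weylGroup :=
  ⟨M.simpleReflection i, Subgroup.subset_closure ⟨i, rfl⟩⟩

theorem weylReflection_mul_self (i : M.realIdx) :
    M.weylReflection i * M.weylReflection i = 1 := by
  apply Subtype.ext
  ext1 μ
  exact simpleReflection_involutive i μ

variable (M) in
/-- The Weyl group element represented by a word in the real indices. -/
noncomputable def wordProd (l : List M.realIdx) : M.weylGroup := (l.map M.weylReflection).prod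

@[simp] theorem wordProd_nil : M.wordProd [] = 1 := rfl

@[simp] theorem wordProd_cons (i : M.realIdx) (l : List M.realIdx) :
    M.wordProd (i :: l) = M.weylReflection i * M.wordProd l := by simp [wordProd]

theorem wordProd_append (l l' : List M.realIdx) :
    M.wordProd (l ++ l') = M.wordProd l * M.wordProd l' := by simp [wordProd]

theorem coe_wordProd (l : List M.realIdx) :
    (M.wordProd l : WeightSpace I ≃ₗ[ℂ] WeightSpace I) = (l.map M.simpleReflection).prod := by
  induction l with
  | nil => rfl
  | cons i l ih => rw [wordProd_cons, Subgroup.coe_mul, ih]; rfl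

theorem wordProd_cons_apply (i : M.realIdx) (l : List M.realIdx) (μ : WeightSpace I) :
    (M.wordProd (i :: l)).1 μ = M.simpleReflection i ((M.wordProd l).1 μ) := by
  rw [wordProd_cons]; rfl

theorem mul_weylReflection_apply (w : M.weylGroup) (i : M.realIdx) (μ : WeightSpace I) :
    (w * M.weylReflection i).1 μ = w.1 μ - μ (coroot (i : I)) • w.1 (M.simpleRoot i) := by
  change w.1 (M.simpleReflection i μ) = _
  rw [simpleReflection_eq, map_sub, map_smul]

theorem exists_wordProd (w : M.weylGroup) : ∃ l, M.wordProd l = w := by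
  obtain ⟨w, hw⟩ := w
  induction hw using Subgroup.closure_induction with
  | mem x hx =>
    obtain ⟨i, rfl⟩ := hx
    exact ⟨[i], by simp; rfl⟩
  | one => exact ⟨[], rfl⟩
  | mul x y hx hy ihx ihy =>
    obtain ⟨l, hl⟩ := ihx
    obtain ⟨l', hl'⟩ := ihy
    exact ⟨l ++ l', by rw [wordProd_append, hl, hl']; rfl⟩
  | inv x hx ih =>
    obtain ⟨l, hl⟩ := ih
    refine ⟨l.reverse, ?_⟩
    change _ = (⟨x, hx⟩ : M.weylGroup)⁻¹
    rw [← hl]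
    clear hl
    induction l with
    | nil => simp
    | cons i l ih =>
      rw [List.reverse_cons, wordProd_append, ih, wordProd_cons, wordProd_cons, mul_inv_rev,
        wordProd_nil, mul_one, inv_eq_of_mul_eq_one_right (weylReflection_mul_self i)]

theorem length_wordProd_le (l : List M.realIdx) : M.length (M.wordProd l) ≤ l.length :=
  Nat.sInf_le ⟨l, rfl, (coe_wordProd l).symm⟩

theorem exists_reduced_word (w : M.weylGroup) :
    ∃ l, M.wordProd l = w ∧ l.length = M.length w := by
  obtain ⟨l₀, h₀⟩ := exists_wordProd w
  have hne : {n | ∃ l : List M.realIdx, l.length = n ∧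
      (l.map M.simpleReflection).prod = (w : WeightSpace I ≃ₗ[ℂ] WeightSpace I)}.Nonempty :=
    ⟨_, l₀, rfl, by rw [← coe_wordProd, h₀]⟩
  obtain ⟨l, hl, hw⟩ := Nat.sInf_mem hne
  exact ⟨l, Subtype.ext (by rw [coe_wordProd, hw]), hl⟩

theorem length_mul_wordProd_le (w : M.weylGroup) (l : List M.realIdx) :
    M.length (w * M.wordProd l) ≤ M.length w + l.length := by
  obtain ⟨l', rfl, hl'⟩ := exists_reduced_word w
  rw [← wordProd_append, ← hl', ← List.length_append]
  exact length_wordProd_le _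

theorem length_eq_zero {w : M.weylGroup} (h : M.length w = 0) : w = 1 := by
  obtain ⟨l, rfl, hl⟩ := exists_reduced_word w
  rw [h, List.length_eq_zero_iff] at hl
  rw [hl, wordProd_nil]

/-- Removing the last letter of a reduced word. -/
theorem exists_eq_mul_weylReflection {w : M.weylGroup} (h : M.length w ≠ 0) :
    ∃ v i, w = v * M.weylReflection i ∧ M.length v < M.length w := by
  obtain ⟨l, rfl, hl⟩ := exists_reduced_word w
  rcases List.eq_nil_or_concat' l with rfl | ⟨l', i, rfl⟩
  · exact absurd hl.symm h
  · refine ⟨M.wordProd l', i, by simp [wordProd_append], ?_⟩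
    rw [← hl, List.length_append, List.length_singleton]
    have := length_wordProd_le l'
    omega

/-- A word only changes the coordinates of its letters. -/
theorem wordProd_apply_derivation (l : List M.realIdx) (i : I) (hi : ∀ j ∈ l, (j : I) ≠ i)
    (μ : WeightSpace I) : (M.wordProd l).1 μ (derivation i) = μ (derivation i) := by
  induction l with
  | nil => rfl
  | cons j l ih =>
    have hj := hi j (by simp)
    rw [wordProd_cons_apply, simpleReflection_eq, LinearMap.sub_apply, LinearMap.smul_apply,
      simpleRoot_derivation_of_ne _ hj.symm, ih fun k hk => hi k (by simp [hk])]
    simp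

theorem weyl_apply_derivation (w : M.weylGroup) {i : I} (hi : i ∉ M.realIdx)
    (μ : WeightSpace I) : w.1 μ (derivation i) = μ (derivation i) := by
  obtain ⟨l, rfl⟩ := exists_wordProd w
  exact wordProd_apply_derivation l i (fun j _ h => hi (h ▸ j.2)) μ

/-! ### Positivity of roots -/

/-- In a rank two subsystem, a word either sends the simple root `α_i` to a nonnegative
combination of the two simple roots, compatibly with the form, or can be shortened when
multiplied by the reflection in `α_i`. -/
theorem rank_two_dichotomy {i j : M.realIdx} (hij : i ≠ j) (l : List M.realIdx)
    (hl : ∀ k ∈ l, k = i ∨ k = j) :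
    (∃ x y : ℕ, (M.wordProd l).1 (M.simpleRoot i) = x • M.simpleRoot i + y • M.simpleRoot j ∧
      ∀ μ : WeightSpace I, (M.d i : ℂ) * μ (coroot (i : I)) =
        x * (M.d i * (M.wordProd l).1 μ (coroot (i : I))) +
          y * (M.d j * (M.wordProd l).1 μ (coroot (j : I)))) ∨
    ∃ l', l'.length < l.length ∧ M.wordProd l' = M.wordProd l * M.weylReflection i := by
  have hij' : (i : I) ≠ j := fun h => hij (Subtype.ext h)
  have hii : M.A i i = 2 := i.2
  have hjj : M.A j j = 2 := j.2
  obtain ⟨a, ha⟩ := M.integral i j i.2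
  obtain ⟨b, hb⟩ := M.integral j i j.2
  have ha0 : a ≤ 0 := by
    have := M.off_diag i j hij'
    rw [ha] at this; exact_mod_cast this
  have hb0 : b ≤ 0 := by
    have := M.off_diag j i hij'.symm
    rw [hb] at this; exact_mod_cast this
  have hsymm := M.symm i j
  rw [ha, hb] at hsymm
  have hsymmC : (M.d i : ℂ) * a = M.d j * b := by exact_mod_cast hsymm
  have hdi := M.d_pos i
  have hdj := M.d_pos j
  have hdiC : (M.d i : ℂ) ≠ 0 := by exact_mod_cast hdi.ne'
  induction l with
  | nil => exact Or.inl ⟨1, 0, by simp, by simp⟩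
  | cons k l ih =>
    rcases ih fun k hk => hl k (by simp [hk]) with ⟨x, y, hg, hp⟩ | ⟨l', hlt, hl'⟩
    swap
    · exact Or.inr ⟨k :: l', by simpa using hlt, by rw [wordProd_cons, wordProd_cons, hl', mul_assoc]⟩
    -- Half of the identity `(α_i, α_i) = (w α_i, w α_i)`, with `w` the product of `l`.
    have hQ : M.d i = x * x * M.d i + x * y * (M.d i * a) + y * y * M.d j := by
      have h := hp (M.simpleRoot i)
      rw [hg] at h
      simp only [LinearMap.add_apply, LinearMap.smul_apply, simpleRoot_coroot, hii, hjj, ha, hb,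
        nsmul_eq_mul] at h
      push_cast at h
      have h2 : (M.d i : ℂ) = x * x * M.d i + x * y * (M.d i * a) + y * y * M.d j := by
        linear_combination h / 2 - x * y / 2 * hsymmC
      exact_mod_cast h2
    have hx0 : (0 : ℝ) ≤ x := x.cast_nonneg
    have hy0 : (0 : ℝ) ≤ y := y.cast_nonneg
    rcases hl k (by simp) with rfl | rfl
    · by_cases hneg : 0 ≤ -(x : ℤ) - a * y
      · obtain ⟨z, hz⟩ := Int.eq_ofNat_of_zero_le hneg
        have hzC : (z : ℂ) = -x - a * y := by
          have := congrArg (Int.cast : ℤ → ℂ) hz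
          push_cast at this; exact this.symm
        refine Or.inl ⟨z, y, ?_, fun μ => ?_⟩
        · rw [wordProd_cons_apply, hg, simpleReflection_eq]
          simp only [LinearMap.add_apply, LinearMap.smul_apply, simpleRoot_coroot, hii, ha,
            ← Nat.cast_smul_eq_nsmul ℂ, hzC, smul_eq_mul]
          push_cast
          module
        · rw [wordProd_cons_apply, simpleReflection_eq, hp μ]
          simp only [LinearMap.sub_apply, LinearMap.smul_apply, simpleRoot_coroot, hii, hb, hzC,
            smul_eq_mul]
          push_cast
          linear_combination (-y * (M.wordProd l).1 μ (coroot (k : I))) * hsymmC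
      -- The new coefficient of `α_i` would be negative. By `hQ`, `d_i = d_i x (x + a y) + d_j y²`,
      -- which leaves only `y = 0` and `x = 1`.
      · have h1 : 1 ≤ (x : ℤ) + a * y := by omega
        have h1R : (1 : ℝ) ≤ x + a * y := by exact_mod_cast h1
        have hy : y = 0 := by
          by_contra hy
          have hy1 : (1 : ℝ) ≤ y := by exact_mod_cast Nat.one_le_iff_ne_zero.2 hy
          have ha0R : (a : ℝ) ≤ 0 := by exact_mod_cast ha0
          have hx1 : (1 : ℝ) ≤ x := by nlinarith
          have h2 : 1 ≤ (x : ℝ) * (x + a * y) := one_le_mul_of_one_le_of_one_le hx1 h1R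
          have h3 : 1 ≤ (y : ℝ) * y := one_le_mul_of_one_le_of_one_le hy1 hy1
          nlinarith
        subst hy
        have hx : x = 1 := by
          have h2 : (x : ℝ) * x = 1 := by
            apply mul_right_cancel₀ hdi.ne'
            simp at hQ; linarith
          have h3 : x * x = 1 := by exact_mod_cast h2
          exact Nat.eq_one_of_mul_eq_one_left h3
        subst hx
        -- Here `w α_i = α_i`, so `w` commutes with `s_i` and `s_i w s_i = w`: dropping the first
        -- letter gives the shorter word.
        refine Or.inr ⟨l, by simp, Subtype.ext (LinearEquiv.ext fun μ => ?_)⟩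
        have h := hp μ
        rw [Nat.cast_one, one_mul, Nat.cast_zero, zero_mul, add_zero] at h
        rw [mul_weylReflection_apply, wordProd_cons_apply, wordProd_cons_apply, hg, one_smul,
          zero_smul, add_zero, mul_left_cancel₀ hdiC h, ← map_smul, ← map_sub,
          ← simpleReflection_eq, simpleReflection_involutive]
    · by_cases hneg : 0 ≤ -(y : ℤ) - b * x
      · obtain ⟨z, hz⟩ := Int.eq_ofNat_of_zero_le hneg
        have hzC : (z : ℂ) = -y - b * x := by
          have := congrArg (Int.cast : ℤ → ℂ) hz
          push_cast at this; exact this.symm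
        refine Or.inl ⟨x, z, ?_, fun μ => ?_⟩
        · rw [wordProd_cons_apply, hg, simpleReflection_eq]
          simp only [LinearMap.add_apply, LinearMap.smul_apply, simpleRoot_coroot, hjj, hb,
            ← Nat.cast_smul_eq_nsmul ℂ, hzC, smul_eq_mul]
          push_cast
          module
        · rw [wordProd_cons_apply, simpleReflection_eq, hp μ]
          simp only [LinearMap.sub_apply, LinearMap.smul_apply, simpleRoot_coroot, hjj, ha, hzC,
            smul_eq_mul]
          push_cast
          linear_combination (x * (M.wordProd l).1 μ (coroot (k : I))) * hsymmC
      · have h1 : 1 ≤ (y : ℤ) + b * x := by omega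
        have h1R : (1 : ℝ) ≤ y + b * x := by exact_mod_cast h1
        rw [hsymm] at hQ
        have hx : x = 0 := by
          by_contra hx
          have hx1 : (1 : ℝ) ≤ x := by exact_mod_cast Nat.one_le_iff_ne_zero.2 hx
          have hb0R : (b : ℝ) ≤ 0 := by exact_mod_cast hb0
          have hy1 : (1 : ℝ) ≤ y := by nlinarith
          have h2 : 1 ≤ (y : ℝ) * (y + b * x) := one_le_mul_of_one_le_of_one_le hy1 h1R
          have h3 : 1 ≤ (x : ℝ) * x := one_le_mul_of_one_le_of_one_le hx1 hx1
          nlinarith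
        subst hx
        have hy : (M.d i : ℂ) = y * y * M.d k := by
          have : M.d i = y * y * M.d k := by simpa using hQ
          exact_mod_cast this
        -- Here `w α_i = y α_j`, so `w s_i = s_j w` and again the first letter cancels.
        refine Or.inr ⟨l, by simp, Subtype.ext (LinearEquiv.ext fun μ => ?_)⟩
        have h := hp μ
        rw [Nat.cast_zero, zero_mul, zero_add] at h
        have h' : μ (coroot (i : I)) * y = (M.wordProd l).1 μ (coroot (k : I)) := by
          apply mul_left_cancel₀ hdiC
          linear_combination y * h - (M.wordProd l).1 μ (coroot (k : I)) * hy
        rw [mul_weylReflection_apply, wordProd_cons_apply, wordProd_cons_apply, hg, zero_smul,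
          zero_add, ← map_smul, ← map_sub, ← Nat.cast_smul_eq_nsmul ℂ, smul_smul, h',
          ← simpleReflection_eq, simpleReflection_involutive]

/-- A Weyl group element sends a simple root to a nonnegative combination of simple roots, unless
it is shortened by the corresponding reflection. -/
theorem apply_simpleRoot_nonneg_or (w : M.weylGroup) (i : M.realIdx) :
    (∃ c : I →₀ ℕ, w.1 (M.simpleRoot i) = M.eta c) ∨
      M.length (w * M.weylReflection i) < M.length w := by
  induction hn : M.length w using Nat.strong_induction_on generalizing w i with
  | _ n ih =>
  subst hn
  by_cases h0 : M.length w = 0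
  · rw [length_eq_zero h0]
    exact Or.inl ⟨Finsupp.single i 1, by simp [eta_single]⟩
  obtain ⟨v, j, hv, hlt⟩ := exists_eq_mul_weylReflection h0
  by_cases hij : i = j
  · subst hij
    right
    rwa [hv, mul_assoc, weylReflection_mul_self, mul_one, ← hv]
  classical
  -- Among length-compatible factorizations of `w` with right factor a word in `s_i, s_j`, take one
  -- whose left factor `u` is shortest. If `u` did not send `α_i` and `α_j` to nonnegative
  -- combinations, a letter could be moved from `u` to the right factor.
  have hex : ∃ n, ∃ (v : M.weylGroup) (l : List M.realIdx), M.length v = n ∧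
      (∀ k ∈ l, k = i ∨ k = j) ∧ w = v * M.wordProd l ∧ M.length v + l.length ≤ M.length w :=
    ⟨_, v, [j], rfl, by simp, by simpa using hv, by simpa using hlt⟩
  obtain ⟨u, l, hu, hl, hw, hlen⟩ := Nat.find_spec hex
  have hmin := fun m (hm : m < Nat.find hex) => Nat.find_min hex hm
  have hult : M.length u < M.length w := by
    rw [hu]
    exact (Nat.find_min' hex ⟨v, [j], rfl, by simp, by simpa using hv, by simpa using hlt⟩).trans_lt
      hlt
  rw [← hu] at hmin
  have key : ∀ k, k = i ∨ k = j → ∃ c : I →₀ ℕ, u.1 (M.simpleRoot k) = M.eta c := by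
    intro k hk
    refine (ih _ hult u k rfl).resolve_right fun hlt' => hmin _ hlt' ⟨_, k :: l, rfl, ?_, ?_, ?_⟩
    · simpa [hk] using hl
    · rw [wordProd_cons, hw, mul_assoc, ← mul_assoc _ _ (M.wordProd l), weylReflection_mul_self,
        one_mul]
    · rw [List.length_cons]; omega
  rcases rank_two_dichotomy hij l hl with ⟨x, y, hg, -⟩ | ⟨l', hl', hl''⟩
  · obtain ⟨c, hc⟩ := key i (Or.inl rfl)
    obtain ⟨c', hc'⟩ := key j (Or.inr rfl)
    refine Or.inl ⟨x • c + y • c', ?_⟩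
    rw [hw]
    change u.1 ((M.wordProd l).1 _) = _
    rw [hg, map_add, map_nsmul, map_nsmul, hc, hc', eta_add, eta_nsmul, eta_nsmul]
  · right
    rw [hw, mul_assoc, ← hl'', ← hw]
    have := length_mul_wordProd_le u l'
    omega

/-! ### Orbits of regular dominant weights -/

variable (M) in
/-- A weight taking positive integral values on the real simple coroots. -/
def IsRegularDominant (μ : WeightSpace I) : Prop :=
  ∀ i : M.realIdx, ∃ m : ℕ, μ (coroot (i : I)) = m + 1

/-- Writing `w = v s_i` with `v` shorter, `w μ = v μ - μ(h_i) v α_i`, where `v α_i` is nonnegative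
and nonzero. Strict positivity of `μ(h_i)` forces `c ≠ 0` for `w ≠ 1`. -/
theorem IsRegularDominant.exists_eta {μ : WeightSpace I} (hμ : M.IsRegularDominant μ)
    (w : M.weylGroup) : ∃ c : I →₀ ℕ, w.1 μ = μ - M.eta c ∧ (c = 0 → w = 1) := by
  induction hn : M.length w using Nat.strong_induction_on generalizing w with
  | _ n ih =>
  subst hn
  by_cases h0 : M.length w = 0
  · rw [length_eq_zero h0]
    exact ⟨0, by simp [eta_zero], fun _ => rfl⟩
  obtain ⟨v, i, rfl, hlt⟩ := exists_eq_mul_weylReflection h0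
  obtain ⟨c, hc, -⟩ := ih _ hlt v rfl
  obtain ⟨r, hr⟩ := (apply_simpleRoot_nonneg_or v i).resolve_right (by omega)
  obtain ⟨m, hm⟩ := hμ i
  refine ⟨c + (m + 1) • r, ?_, fun h => ?_⟩
  · rw [mul_weylReflection_apply, hc, hm, hr, eta_add, eta_nsmul, ← Nat.cast_smul_eq_nsmul ℂ]
    push_cast
    abel
  · exfalso
    have hr0 : r = 0 := by
      ext k
      have := DFunLike.congr_fun h k
      simp at this
      simpa using this.2
    rw [hr0, eta_zero] at hr
    have h1 : M.simpleRoot i = 0 := by simpa using hr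
    have h2 := M.simpleRoot_derivation_self i
    rw [h1] at h2
    simp at h2

theorem IsRegularDominant.apply_injective {μ : WeightSpace I} (hμ : M.IsRegularDominant μ)
    {v w : M.weylGroup} (h : v.1 μ = w.1 μ) : v = w := by
  obtain ⟨c, hc, hc1⟩ := hμ.exists_eta (w⁻¹ * v)
  have h1 : (w⁻¹ * v).1 μ = μ := by
    change w.1.symm (v.1 μ) = μ
    rw [h, LinearEquiv.symm_apply_apply]
  have h2 : M.eta c = M.eta 0 := by
    rw [h1] at hc
    rw [eta_zero]
    exact sub_eq_self.1 hc.symm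
  exact (inv_mul_eq_one.1 (hc1 (M.eta_injective h2))).symm

/-- The action of a product of mutually orthogonal simple reflections. -/
theorem wordProd_apply_of_orthogonal (l : List M.realIdx)
    (hl : l.Pairwise fun i j : M.realIdx => M.A i j = 0) (μ : WeightSpace I) :
    (M.wordProd l).1 μ = μ - (l.map fun i : M.realIdx => μ (coroot (i : I)) • M.simpleRoot i).sum := by
  induction l with
  | nil => simp
  | cons i l ih =>
    rw [List.pairwise_cons] at hl
    rw [wordProd_cons_apply, simpleReflection_eq, ih hl.2, List.map_cons, List.sum_cons]
    have h0 : (l.map fun j : M.realIdx => μ (coroot (j : I)) • M.simpleRoot j).sum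
        (coroot (i : I)) = 0 := by
      have h := hl.1
      clear ih hl
      induction l with
      | nil => simp
      | cons k l ih =>
        rw [List.map_cons, List.sum_cons, LinearMap.add_apply,
          ih fun j hj => h j (by simp [hj]), LinearMap.smul_apply, simpleRoot_coroot,
          h k (by simp)]
        simp
    rw [LinearMap.sub_apply, h0, sub_zero]
    abel

end BKMSupermatrix

/-- The indicator functions of finite independent sets of vertices of a graph. -/
def IsIndepIndicator {I : Type*} (G : SimpleGraph I) (β : I →₀ ℕ) : Prop :=
  (∀ i, β i ≤ 1) ∧ ∀ i j, G.Adj i j → β i = 0 ∨ β j = 0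

/-! ### Multiplicity-free differences and orthogonal reflections -/

namespace BKMSupermatrix

variable {I : Type*} {M : BKMSupermatrix I}

theorem sum_smul_simpleRoot_derivation (l : List M.realIdx) (f : M.realIdx → ℂ) (i : I)
    (hi : ∀ j ∈ l, (j : I) ≠ i) :
    (l.map fun j : M.realIdx => f j • M.simpleRoot j).sum (derivation i) = 0 := by
  induction l with
  | nil => simp
  | cons j l ih =>
    rw [List.map_cons, List.sum_cons, LinearMap.add_apply, ih fun k hk => hi k (by simp [hk]),
      LinearMap.smul_apply, simpleRoot_derivation_of_ne _ (hi j (by simp)).symm]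
    simp

theorem sum_smul_simpleRoot_derivation_of_mem {l : List M.realIdx} (hl : l.Nodup)
    (f : M.realIdx → ℂ) {i : M.realIdx} (hi : i ∈ l) :
    (l.map fun j : M.realIdx => f j • M.simpleRoot j).sum (derivation (i : I)) = f i := by
  induction l with
  | nil => simp at hi
  | cons j l ih =>
    rw [List.nodup_cons] at hl
    rw [List.map_cons, List.sum_cons, LinearMap.add_apply, LinearMap.smul_apply]
    rcases List.mem_cons.1 hi with rfl | hi
    · rw [simpleRoot_derivation_self, sum_smul_simpleRoot_derivation]
      · simp
      · intro k hk h
        exact hl.1 (Subtype.ext h ▸ hk)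
    · rw [simpleRoot_derivation_of_ne, ih hl.2 hi]
      · simp
      · intro h
        exact hl.1 (Subtype.ext h ▸ hi)

/-- If `μ - w μ` is a multiplicity free sum of simple roots, then `w` is a product of mutually
orthogonal simple reflections, each of which subtracts its simple root from `μ`. -/
theorem IsRegularDominant.exists_orthogonal_word {μ : WeightSpace I}
    (hμ : M.IsRegularDominant μ) (w : M.weylGroup) (c : I →₀ ℕ) (hw : w.1 μ = μ - M.eta c)
    (hc : ∀ i, c i ≤ 1) :
    ∃ l : List M.realIdx, M.wordProd l = w ∧ l.Nodup ∧
      (l.Pairwise fun i j : M.realIdx => M.A i j = 0) ∧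
      ∀ i ∈ l, μ (coroot (i : I)) = 1 := by
  induction hn : M.length w using Nat.strong_induction_on generalizing w c with
  | _ n ih =>
  subst hn
  by_cases h0 : M.length w = 0
  · exact ⟨[], (length_eq_zero h0).symm, by simp, by simp, by simp⟩
  obtain ⟨v, i, rfl, hlt⟩ := exists_eq_mul_weylReflection h0
  obtain ⟨c', hc', -⟩ := hμ.exists_eta v
  obtain ⟨r, hr⟩ := (apply_simpleRoot_nonneg_or v i).resolve_right (by omega)
  obtain ⟨m, hm⟩ := hμ i
  have hcr : c = c' + (m + 1) • r := by
    apply M.eta_injective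
    rw [mul_weylReflection_apply, hc', hm, hr] at hw
    rw [eta_add, eta_nsmul, ← Nat.cast_smul_eq_nsmul ℂ]
    push_cast
    exact sub_right_injective (hw.symm.trans (sub_sub _ _ _))
  have hck : ∀ k, c k = c' k + (m + 1) * r k := fun k => by simp [hcr]
  obtain ⟨l, rfl, hnd, hpw, h1⟩ := ih _ hlt v c' hc'
    (fun k => (by have := hck k; have := hc k; omega)) rfl
  have hvi := wordProd_apply_of_orthogonal l hpw (M.simpleRoot i)
  have hvμ := wordProd_apply_of_orthogonal l hpw μ
  rw [hr] at hvi
  rw [hc'] at hvμ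
  -- By orthogonality, `v α_i = α_i - ∑_{j ∈ l} a_{ji} α_j`. If `i ∈ l`, its `α_i` coefficient would
  -- be `1 - 2 = -1`, contradicting nonnegativity.
  have hil : i ∉ l := by
    intro hil
    have h := congrArg (fun ν => ν (derivation (i : I))) hvi
    simp only [LinearMap.sub_apply] at h
    rw [eta_derivation, simpleRoot_derivation_self,
      sum_smul_simpleRoot_derivation_of_mem hnd _ hil, simpleRoot_coroot,
      show M.A i i = 2 from i.2] at h
    have h2 : ((r i + 1 : ℕ) : ℂ) = 0 := by push_cast at h ⊢; rw [h]; norm_num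
    exact absurd (Nat.cast_eq_zero.1 h2) (by omega)
  have hri : r i = 1 := by
    have h := congrArg (fun ν => ν (derivation (i : I))) hvi
    simp only [LinearMap.sub_apply] at h
    rw [eta_derivation, simpleRoot_derivation_self, sum_smul_simpleRoot_derivation, sub_zero] at h
    · exact_mod_cast h
    · intro j hj h
      exact hil (Subtype.ext h ▸ hj)
  have hm0 : m = 0 := by
    have := hck i
    rw [hri] at this
    have := hc i
    omega
  subst hm0
  refine ⟨l ++ [i], by simp [wordProd_append], ?_, ?_, ?_⟩
  · simpa [List.nodup_append, hnd] using fun a b h e => hil (by rwa [← e])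
  · rw [List.pairwise_append]
    refine ⟨hpw, by simp, fun j hj k hk => ?_⟩
    rw [List.mem_singleton.1 hk]
    have hji : (j : I) ≠ i := fun h => hil (Subtype.ext h ▸ hj)
    -- `α_j` has already been subtracted once by `v`, so multiplicity freeness leaves no `α_j` in `v
    -- α_i`; its coefficient there is `-a_{ji}`.
    have hc'j : c' j = 1 := by
      have h := congrArg (fun ν => ν (derivation (j : I))) hvμ
      simp only [LinearMap.sub_apply] at h
      rw [eta_derivation, sum_smul_simpleRoot_derivation_of_mem hnd _ hj, h1 j hj] at h
      exact_mod_cast sub_right_injective h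
    have hrj : r j = 0 := by
      have := hck j
      have := hc j
      omega
    have h := congrArg (fun ν => ν (derivation (j : I))) hvi
    simp only [LinearMap.sub_apply] at h
    rw [eta_derivation, sum_smul_simpleRoot_derivation_of_mem hnd _ hj, hrj,
      simpleRoot_derivation_of_ne _ hji, simpleRoot_coroot] at h
    simpa using h
  · intro j hj
    rcases List.mem_append.1 hj with hj | hj
    · exact h1 j hj
    · rw [List.mem_singleton.1 hj, hm]; simp

/-- The product changes the `α_i` coordinate of `μ` for every `i ∈ l`, so any word representing it
must contain every letter of `l`. -/
theorem length_wordProd_of_orthogonal {l : List M.realIdx} (hnd : l.Nodup)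
    (hpw : l.Pairwise fun i j : M.realIdx => M.A i j = 0) {μ : WeightSpace I}
    (hμ : ∀ i ∈ l, μ (coroot (i : I)) = 1) : M.length (M.wordProd l) = l.length := by
  refine le_antisymm (length_wordProd_le l) ?_
  obtain ⟨l', hl', hlen⟩ := exists_reduced_word (M.wordProd l)
  rw [← hlen]
  refine (List.subperm_of_subset hnd fun i hi => ?_).length_le
  by_contra hi'
  have h1 := wordProd_apply_derivation l' i (fun j hj h => hi' (Subtype.ext h ▸ hj)) μ
  rw [hl', wordProd_apply_of_orthogonal l hpw, LinearMap.sub_apply,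
    sum_smul_simpleRoot_derivation_of_mem hnd _ hi, hμ i hi] at h1
  simp at h1

/-! ### The terms of the sum side -/

theorem eta_coroot_eq_neg_natCast {γ : I →₀ ℕ} (hγ : ∀ i, γ i ≠ 0 → i ∉ M.realIdx)
    (i : M.realIdx) : ∃ m : ℕ, M.eta γ (coroot (i : I)) = -m := by
  rw [eta_coroot, Finsupp.sum]
  choose a ha using fun j => M.integral i j i.2
  have hle : ∑ j ∈ γ.support, (γ j : ℤ) * a j ≤ 0 := by
    refine Finset.sum_nonpos fun j hj => mul_nonpos_of_nonneg_of_nonpos (by positivity) ?_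
    have h := M.off_diag i j fun h => hγ j (Finsupp.mem_support_iff.1 hj) (h ▸ i.2)
    rw [ha] at h
    exact_mod_cast h
  obtain ⟨m, hm⟩ := Int.eq_ofNat_of_zero_le (neg_nonneg.2 hle)
  refine ⟨m, ?_⟩
  have h := congrArg (Int.cast : ℤ → ℂ) (neg_eq_iff_eq_neg.1 hm)
  push_cast at h
  rw [← h]
  exact Finset.sum_congr rfl fun j _ => by rw [ha]; push_cast; rfl

/-- Every summand `γ_j a_{ij}` is nonpositive, since `i` is real and `γ` is supported on imaginary
indices; no cancellation can occur. -/
theorem eta_coroot_eq_zero_iff {γ : I →₀ ℕ} (hγ : ∀ i, γ i ≠ 0 → i ∉ M.realIdx)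
    (i : M.realIdx) : M.eta γ (coroot (i : I)) = 0 ↔ ∀ j, γ j ≠ 0 → M.A i j = 0 := by
  have h : M.eta γ (coroot (i : I)) = ((∑ j ∈ γ.support, γ j * M.A i j : ℝ) : ℂ) := by
    rw [eta_coroot, Finsupp.sum]; push_cast; rfl
  rw [h, Complex.ofReal_eq_zero, Finset.sum_eq_zero_iff_of_nonpos]
  · refine forall_congr' fun j => ?_
    rw [Finsupp.mem_support_iff]
    refine imp_congr_right fun hj => ?_
    rw [mul_eq_zero, Nat.cast_eq_zero, or_iff_right hj]
  · intro j hj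
    exact mul_nonpos_of_nonneg_of_nonpos (by positivity)
      (M.off_diag i j fun h => hγ j (Finsupp.mem_support_iff.1 hj) (h ▸ i.2))

theorem IsWeylVector.apply_coroot {ρ : WeightSpace I} (hρ : M.IsWeylVector ρ) (i : M.realIdx) :
    ρ (coroot (i : I)) = 1 := by
  have h := hρ i
  have hd : (M.d i : ℂ) ≠ 0 := by exact_mod_cast (M.d_pos i).ne'
  rw [form_apply, form_simpleRoot, show M.A i i = 2 from i.2] at h
  apply mul_left_cancel₀ hd
  push_cast at h
  linear_combination h / 2

theorem IsWeylVector.isRegularDominant {ρ : WeightSpace I} (hρ : M.IsWeylVector ρ)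
    {γ : I →₀ ℕ} (hγ : γ ∈ M.Omega) : M.IsRegularDominant (ρ - M.eta γ) := by
  intro i
  obtain ⟨m, hm⟩ := eta_coroot_eq_neg_natCast hγ.1 i
  exact ⟨m, by rw [LinearMap.sub_apply, hm, hρ.apply_coroot]; ring⟩

theorem mem_termsAt {ρ : WeightSpace I} {β : I →₀ ℕ} {p : M.weylGroup × M.Omega} :
    p ∈ M.termsAt ρ β ↔ p.1.1 (ρ - M.eta p.2) = ρ - M.eta β := by
  change _ - ρ = - _ ↔ _
  rw [sub_eq_iff_eq_add, neg_add_eq_sub]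

theorem IsWeylVector.exists_mem_termsAt {ρ : WeightSpace I} (hρ : M.IsWeylVector ρ)
    (w : M.weylGroup) (γ : M.Omega) : ∃ β : I →₀ ℕ, (w, γ) ∈ M.termsAt ρ β := by
  obtain ⟨c, hc, -⟩ := (hρ.isRegularDominant γ.2).exists_eta w
  exact ⟨γ + c, mem_termsAt.2 (by rw [hc, eta_add, sub_sub])⟩

theorem apply_eq_of_mem_termsAt {ρ : WeightSpace I} {β : I →₀ ℕ} {p : M.weylGroup × M.Omega}
    (hp : p ∈ M.termsAt ρ β) {i : I} (hi : i ∉ M.realIdx) : p.2.1 i = β i := by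
  have h := congrArg (fun μ => μ (derivation i)) (mem_termsAt.1 hp)
  simp only [weyl_apply_derivation _ hi, LinearMap.sub_apply, eta_derivation] at h
  exact_mod_cast sub_right_injective h

/-- The Weyl group fixes the imaginary coordinates, so `γ` is the imaginary part of `β`. Then `w` is
determined because `ρ - γ` has trivial stabilizer. -/
theorem IsWeylVector.termsAt_subsingleton {ρ : WeightSpace I} (hρ : M.IsWeylVector ρ)
    (β : I →₀ ℕ) : (M.termsAt ρ β).Subsingleton := by
  rintro ⟨v, γ⟩ hp ⟨w, δ⟩ hq
  have hγδ : γ = δ := by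
    apply Subtype.ext
    ext i
    by_cases hi : i ∈ M.realIdx
    · have h1 : γ.1 i = 0 := not_not.1 fun h => γ.2.1 i h hi
      have h2 : δ.1 i = 0 := not_not.1 fun h => δ.2.1 i h hi
      rw [h1, h2]
    · exact (apply_eq_of_mem_termsAt hp hi).trans (apply_eq_of_mem_termsAt hq hi).symm
  subst hγδ
  exact Prod.ext ((hρ.isRegularDominant γ.2).apply_injective
    ((mem_termsAt.1 hp).trans (mem_termsAt.1 hq).symm)) rfl

theorem isIndepIndicator_iff {β : I →₀ ℕ} : IsIndepIndicator M.quasiDynkin β ↔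
    (∀ i, β i ≤ 1) ∧ ∀ i j, i ≠ j → β i ≠ 0 → β j ≠ 0 → M.A i j = 0 := by
  refine and_congr_right fun _ => forall₂_congr fun i j => ?_
  change (i ≠ j ∧ M.A i j ≠ 0 → _) ↔ _
  tauto

theorem form_simpleRoot_eq_zero {i j : I} : M.form i (M.simpleRoot j) = 0 ↔ M.A i j = 0 := by
  rw [form_simpleRoot, mul_eq_zero, or_iff_right (by exact_mod_cast (M.d_pos i).ne'),
    Complex.ofReal_eq_zero]

theorem height_add (b c : I →₀ ℕ) : height (b + c) = height b + height c :=
  Finsupp.sum_add_index' (by simp) (by simp)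

/-- Only independent sets contribute to the sum side in free degrees. -/
theorem IsWeylVector.isIndepIndicator_of_mem_termsAt {ρ : WeightSpace I} (hρ : M.IsWeylVector ρ)
    {β : I →₀ ℕ} (hβ : M.IsFree β) {p : M.weylGroup × M.Omega} (hp : p ∈ M.termsAt ρ β) :
    IsIndepIndicator M.quasiDynkin β := by
  obtain ⟨w, γ⟩ := p
  have hdom := hρ.isRegularDominant γ.2
  obtain ⟨c, hc, -⟩ := hdom.exists_eta w
  have hβc : β = γ + c := by
    apply M.eta_injective
    have h := (mem_termsAt.1 hp).symm.trans hc
    rw [sub_sub, ← eta_add] at h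
    exact sub_right_injective h
  have hβi : ∀ i, β i = γ.1 i + c i := fun i => by rw [hβc]; rfl
  have him : ∀ i, i ∉ M.realIdx → c i = 0 := fun i hi => by
    have := apply_eq_of_mem_termsAt hp hi
    have := hβi i
    simp only at *
    omega
  have hre : ∀ i, i ∈ M.realIdx → γ.1 i = 0 := fun i hi => not_not.1 fun h => γ.2.1 i h hi
  -- Freeness bounds the real coordinates. At an imaginary index a coefficient `≥ 2` in `Ω` requires
  -- an odd isotropic root, hence an index of `Ψ₀`, where freeness applies again.
  have hβ1 : ∀ i, β i ≤ 1 := by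
    intro i
    by_cases hi : i ∈ M.realIdx
    · exact hβ i (Or.inl hi)
    have h1 := hβi i
    rw [him i hi, add_zero] at h1
    by_cases hodd : i ∈ M.odd
    · by_contra hgt
      exact hgt (hβ i (Or.inr ⟨hodd, form_simpleRoot_eq_zero.1 (γ.2.2.2.2 i hodd (by omega))⟩))
    · rw [h1]; exact γ.2.2.1 i hodd
  obtain ⟨l, rfl, hnd, hpw, h1⟩ := hdom.exists_orthogonal_word w c hc fun i => by
    have := hβi i
    have := hβ1 i
    omega
  have hsupp : ∀ i, c i ≠ 0 → ∃ hi : i ∈ M.realIdx, (⟨i, hi⟩ : M.realIdx) ∈ l := by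
    intro i hi
    have hir : i ∈ M.realIdx := by_contra fun h => hi (him i h)
    refine ⟨hir, by_contra fun hil => hi ?_⟩
    have h := wordProd_apply_derivation l i
      (fun j hj h => hil (by rwa [← (Subtype.ext h : j = ⟨i, hir⟩)])) (ρ - M.eta γ)
    rw [hc, LinearMap.sub_apply, eta_derivation, sub_eq_self] at h
    exact_mod_cast h
  -- Both `ρ` and `ρ - γ` take the value `1` on `h_i`, so `γ` vanishes there.
  have hγl : ∀ i ∈ l, ∀ j, γ.1 j ≠ 0 → M.A i j = 0 := by
    intro i hi
    rw [← eta_coroot_eq_zero_iff γ.2.1]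
    have h := h1 i hi
    rwa [LinearMap.sub_apply, hρ.apply_coroot, sub_eq_self] at h
  refine isIndepIndicator_iff.2 ⟨hβ1, fun i j hij hi hj => ?_⟩
  rw [hβi] at hi hj
  by_cases hci : c i = 0 <;> by_cases hcj : c j = 0
  · exact form_simpleRoot_eq_zero.1 (γ.2.2.2.1 i j hij (by omega) (by omega))
  · obtain ⟨hjr, hjl⟩ := hsupp j hcj
    exact (M.zero_iff i j).2 (hγl _ hjl i (by omega))
  · obtain ⟨hir, hil⟩ := hsupp i hci
    exact hγl _ hil j (by omega)
  · obtain ⟨hir, hil⟩ := hsupp i hci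
    obtain ⟨hjr, hjl⟩ := hsupp j hcj
    have : Std.Symm fun i j : M.realIdx => M.A i j = 0 := ⟨fun i j h => (M.zero_iff i j).1 h⟩
    exact hpw.forall hil hjl
      (fun h => hij (congrArg Subtype.val h))

/-- The term of the sum side that belongs to an independent set. -/
theorem IsWeylVector.exists_mem_termsAt_of_isIndepIndicator {ρ : WeightSpace I}
    (hρ : M.IsWeylVector ρ) {β : I →₀ ℕ} (hβ : IsIndepIndicator M.quasiDynkin β) :
    ∃ p ∈ M.termsAt ρ β, M.length p.1 + height (p.2 : I →₀ ℕ) = height β := by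
  classical
  rw [isIndepIndicator_iff] at hβ
  have hβ1 := hβ.1
  -- The imaginary vertices of the independent set give `γ`; the real ones give the commuting
  -- reflections whose product is `w`.
  set γ : I →₀ ℕ := β.filter (· ∉ M.realIdx) with hγ
  have hγne : ∀ i, γ i ≠ 0 → i ∉ M.realIdx ∧ β i ≠ 0 := by
    intro i hi
    rw [hγ, Finsupp.filter_apply] at hi
    simpa using hi
  have hγle : ∀ i, γ i ≤ 1 := by
    intro i
    rw [hγ, Finsupp.filter_apply]
    split_ifs
    exacts [zero_le_one, hβ1 i]
  have hγΩ : γ ∈ M.Omega :=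
    ⟨fun i hi => (hγne i hi).1, fun i _ => hγle i,
      fun i j hij hi hj => form_simpleRoot_eq_zero.2 (hβ.2 i j hij (hγne i hi).2 (hγne j hj).2),
      fun i _ hi => absurd (hγle i) (by omega)⟩
  set s : Finset M.realIdx := β.support.subtype (· ∈ M.realIdx) with hs
  set l : List M.realIdx := s.toList with hl
  have hmem : ∀ i ∈ l, β i ≠ 0 := by
    intro i hi
    rw [hl, Finset.mem_toList, hs, Finset.mem_subtype] at hi
    exact Finsupp.mem_support_iff.1 hi
  have hpw : l.Pairwise fun i j : M.realIdx => M.A i j = 0 :=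
    s.nodup_toList.pairwise_of_forall_ne fun i hi j hj hij =>
      hβ.2 i j (fun h => hij (Subtype.ext h)) (hmem i hi) (hmem j hj)
  have hone : ∀ i ∈ l, (ρ - M.eta γ) (coroot (i : I)) = 1 := by
    intro i hi
    rw [LinearMap.sub_apply, hρ.apply_coroot, sub_eq_self,
      eta_coroot_eq_zero_iff fun j hj => (hγne j hj).1]
    exact fun j hj => hβ.2 i j (fun h => (hγne j hj).1 (h ▸ i.2)) (hmem i hi) (hγne j hj).2
  have hsplit : β = γ + ∑ i ∈ s, Finsupp.single (i : I) 1 := by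
    ext i
    rw [Finsupp.add_apply, Finsupp.finsetSum_apply, hγ, Finsupp.filter_apply]
    by_cases hi : i ∈ M.realIdx
    · rw [if_neg (not_not.2 hi), zero_add]
      by_cases h0 : β i = 0
      · rw [h0]
        refine (Finset.sum_eq_zero fun j hj => ?_).symm
        refine Finsupp.single_eq_of_ne fun h => ?_
        exact hmem j (Finset.mem_toList.2 hj) (h ▸ h0)
      · have his : (⟨i, hi⟩ : M.realIdx) ∈ s := by
          rw [hs, Finset.mem_subtype]; exact Finsupp.mem_support_iff.2 h0
        rw [Finset.sum_eq_single_of_mem _ his fun j _ hj =>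
          Finsupp.single_eq_of_ne fun h => hj (Subtype.ext h.symm)]
        have := hβ1 i
        simp
        omega
    · rw [if_pos hi, Finset.sum_eq_zero, add_zero]
      intro j _
      exact Finsupp.single_eq_of_ne fun h => hi (h ▸ j.2)
  have hsum : ∀ t : Finset M.realIdx, M.eta (∑ i ∈ t, Finsupp.single (i : I) 1) =
      ∑ i ∈ t, M.simpleRoot i ∧ height (∑ i ∈ t, Finsupp.single (i : I) 1) = t.card := by
    intro t
    induction t using Finset.induction_on with
    | empty => simp [eta_zero, height]
    | insert i t hi ih =>
      rw [Finset.sum_insert hi, Finset.sum_insert hi, Finset.card_insert_of_notMem hi, eta_add,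
        height_add, ih.1, ih.2, eta_single, one_smul]
      exact ⟨rfl, by simp [height, add_comm]⟩
  refine ⟨(M.wordProd l, ⟨γ, hγΩ⟩), mem_termsAt.2 ?_, ?_⟩
  · change (M.wordProd l).1 (ρ - M.eta γ) = _
    rw [wordProd_apply_of_orthogonal l hpw, List.map_congr_left (g := fun i : M.realIdx => M.simpleRoot i)
      (fun i hi => by rw [hone i hi, one_smul]), hl, Finset.sum_map_toList, hsplit, eta_add,
      (hsum s).1, sub_sub]
  · change M.length (M.wordProd l) + height γ = _
    rw [length_wordProd_of_orthogonal s.nodup_toList hpw hone, Finset.length_toList,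
      hsplit, height_add, (hsum s).2, add_comm]

open Classical in
/-- In free degrees, the sum side is the signed independence series of the diagram. -/
theorem IsWeylVector.coeff_U {ρ : WeightSpace I} (hρ : M.IsWeylVector ρ) {β : I →₀ ℕ}
    (hβ : M.IsFree β) : MvPowerSeries.coeff β (M.U ρ) =
      if IsIndepIndicator M.quasiDynkin β then (-1) ^ height β else 0 := by
  change ∑ᶠ p ∈ M.termsAt ρ β, (-1 : ℂ) ^ M.length p.1 * (-1 : ℂ) ^ height (p.2 : I →₀ ℕ) = _
  split_ifs with h
  · obtain ⟨p, hp, hlen⟩ := hρ.exists_mem_termsAt_of_isIndepIndicator h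
    rw [(hρ.termsAt_subsingleton β).eq_singleton_of_mem hp, finsum_mem_singleton, ← pow_add, hlen]
  · have : M.termsAt ρ β = ∅ :=
      Set.eq_empty_of_forall_notMem fun p hp => h (hρ.isIndepIndicator_of_mem_termsAt hβ hp)
    rw [this, finsum_mem_empty]

end BKMSupermatrix

/-! ### Multicolorings and powers of the independence series -/

section Multicoloring

variable {I : Type*} {G : SimpleGraph I} {k : I →₀ ℕ}

open Classical in
/-- Proper multicolorings with `q` colors are the same as decompositions of `k` into `q` indicator
functions of independent sets, one for each color class. -/
noncomputable def multicoloringEquiv (G : SimpleGraph I) (k : I →₀ ℕ) (q : ℕ) :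
    {f : Fin q → (I →₀ ℕ) // ∑ c, f c = k ∧ ∀ c, IsIndepIndicator G (f c)} ≃
      Multicoloring G k q where
  toFun f := ⟨fun i => Finset.univ.filter fun c => f.1 c i ≠ 0, fun i => by
      rw [Finset.card_filter, ← DFunLike.congr_fun f.2.1 i, Finsupp.finsetSum_apply]
      refine Finset.sum_congr rfl fun c _ => ?_
      have := (f.2.2 c).1 i
      split_ifs with h <;> omega, fun i j hij => by
      refine Finset.disjoint_left.2 fun c hi hj => ?_
      simp only [Finset.mem_filter, Finset.mem_univ, true_and] at hi hj
      exact ((f.2.2 c).2 i j hij).elim hi hj⟩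
  invFun τ := ⟨fun c => Finsupp.onFinset k.support (fun i => if c ∈ τ.1 i then 1 else 0)
      fun i hi => by
        rw [Finsupp.mem_support_iff, ← τ.2.1 i]
        exact Finset.card_ne_zero_of_mem (by simpa using hi), by
      ext i
      rw [Finsupp.finsetSum_apply, ← τ.2.1 i]
      simp, fun c => ⟨fun i => by
        rw [Finsupp.onFinset_apply]
        split_ifs <;> simp, fun i j hij => by
        simp only [Finsupp.onFinset_apply, ite_eq_right_iff, one_ne_zero, imp_false]
        by_contra! h
        exact Finset.disjoint_left.1 (τ.2.2 i j hij) h.1 h.2⟩⟩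
  left_inv f := by
    apply Subtype.ext
    funext c
    ext i
    have := (f.2.2 c).1 i
    simp only [Finsupp.onFinset_apply, Finset.mem_filter, Finset.mem_univ, true_and]
    split_ifs with h <;> omega
  right_inv τ := by
    apply Subtype.ext
    funext i
    ext c
    simp

open Classical in
/-- The coefficients of the powers of the signed independence series count multicolorings. -/
theorem coeff_pow_eq_card_multicoloring {F : MvPowerSeries I ℂ}
    (hF : ∀ β ≤ k, MvPowerSeries.coeff β F =
      if IsIndepIndicator G β then (-1) ^ BKMSupermatrix.height β else 0) (q : ℕ) :
    MvPowerSeries.coeff k (F ^ q) =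
      (-1) ^ BKMSupermatrix.height k * (Nat.card (Multicoloring G k q) : ℂ) := by
  have hprod : F ^ q = ∏ _c : Fin q, F := by simp
  rw [hprod, MvPowerSeries.coeff_prod]
  -- Heights add up to that of `k`, so all nonzero products carry the same sign.
  have hterm : ∀ l ∈ Finset.finsuppAntidiag (Finset.univ : Finset (Fin q)) k,
      ∏ c, MvPowerSeries.coeff (l c) F =
        if ∀ c, IsIndepIndicator G (l c) then (-1) ^ BKMSupermatrix.height k else 0 := by
    intro l hl
    have hsum : ∑ c, l c = k := (Finset.mem_finsuppAntidiag.1 hl).1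
    have hle : ∀ c, l c ≤ k := fun c => by
      rw [← hsum]
      exact Finset.single_le_sum (f := fun c => l c) (fun _ _ => zero_le) (Finset.mem_univ c)
    rw [Finset.prod_congr rfl fun c _ => hF (l c) (hle c)]
    split_ifs with h
    · rw [Finset.prod_congr rfl fun c _ => if_pos (h c), Finset.prod_pow_eq_pow_sum, ← hsum]
      congr 1
      exact (map_sum (⟨⟨BKMSupermatrix.height, rfl⟩, BKMSupermatrix.height_add⟩ :
        (I →₀ ℕ) →+ ℕ) (fun c => l c) Finset.univ).symm
    · obtain ⟨c, hc⟩ := not_forall.1 h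
      exact Finset.prod_eq_zero (Finset.mem_univ c) (if_neg hc)
  rw [Finset.sum_congr rfl hterm, ← Finset.sum_filter, Finset.sum_const, nsmul_eq_mul, mul_comm,
    ← Nat.card_congr (multicoloringEquiv G k q), ← Nat.card_eq_finsetCard]
  congr 2
  refine Nat.card_congr (Finsupp.equivFunOnFinite.subtypeEquiv fun l => ?_)
  simp

end Multicoloring

/-! ### Integral powers of units -/

/-- The truncated binomial series for an integral power of a unit. -/
theorem sub_one_pow_dvd_zpow_sub_sum {R : Type*} [CommRing R] (u : Rˣ) (N : ℕ) (q : ℤ) :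
    ((u : R) - 1) ^ (N + 1) ∣ ((u ^ q : Rˣ) : R) -
      ∑ m ∈ Finset.range (N + 1), ((Ring.choose q m : ℤ) : R) * ((u : R) - 1) ^ m := by
  set n : R := (u : R) - 1 with hn
  have hu : (u : R) = 1 + n := by rw [hn]; ring
  -- Pascal's rule for generalized binomial coefficients: multiplying the truncated series by `1 +
  -- n` overshoots by one term of degree `N + 1`.
  have hstep : ∀ q : ℤ, ∑ m ∈ Finset.range (N + 1), ((Ring.choose (q + 1) m : ℤ) : R) * n ^ m =
      u * ∑ m ∈ Finset.range (N + 1), ((Ring.choose q m : ℤ) : R) * n ^ m -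
        n ^ (N + 1) * ((Ring.choose q N : ℤ) : R) := by
    intro q
    rw [hu, add_mul, one_mul, Finset.sum_range_succ', Finset.mul_sum,
      Finset.sum_range_succ (fun m => n * _), Finset.sum_range_succ' (fun m => _ * n ^ m)]
    simp only [Ring.choose_succ_succ, Ring.choose_zero_right, Int.cast_add, add_mul,
      Finset.sum_add_distrib]
    have : ∑ m ∈ Finset.range N, ((Ring.choose q m : ℤ) : R) * n ^ (m + 1) =
        ∑ m ∈ Finset.range N, n * (((Ring.choose q m : ℤ) : R) * n ^ m) :=
      Finset.sum_congr rfl fun m _ => by ring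
    rw [this]
    ring
  have hrec : ∀ q : ℤ, ((u ^ (q + 1) : Rˣ) : R) -
      ∑ m ∈ Finset.range (N + 1), ((Ring.choose (q + 1) m : ℤ) : R) * n ^ m =
      u * (((u ^ q : Rˣ) : R) - ∑ m ∈ Finset.range (N + 1), ((Ring.choose q m : ℤ) : R) * n ^ m) +
        n ^ (N + 1) * ((Ring.choose q N : ℤ) : R) := by
    intro q
    rw [hstep, zpow_add_one, Units.val_mul]
    ring
  induction q using Int.induction_on with
  | zero =>
    rw [Finset.sum_range_succ']
    simp
  | succ q ih =>
    rw [hrec]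
    exact (ih.mul_left _).add (dvd_mul_right _ _)
  -- The same recursion runs downwards because the factor `u` is a unit.
  | pred q ih =>
    have h := hrec (-(q : ℤ) - 1)
    rw [sub_add_cancel] at h
    rw [h, dvd_add_left (dvd_mul_right _ _), Units.dvd_mul_left] at ih
    exact ih

/-- Modulo terms of degree above that of `k`, `u ^ q` is a finite combination of powers of `u - 1`
with coefficients polynomial in `q`. Rationality of the values at natural `q` makes the polynomial
rational. -/
theorem MvPowerSeries.exists_polynomial_coeff_zpow {σ K : Type*} [Field K] [CharZero K]
    (u : (MvPowerSeries σ K)ˣ) (hu : MvPowerSeries.constantCoeff (u : MvPowerSeries σ K) = 1)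
    (k : σ →₀ ℕ) (f : ℕ → ℚ)
    (hf : ∀ q : ℕ, MvPowerSeries.coeff k ((u : MvPowerSeries σ K) ^ q) = f q) :
    ∃ P : ℚ[X], ∀ q : ℤ, MvPowerSeries.coeff k ((u ^ q : (MvPowerSeries σ K)ˣ) :
      MvPowerSeries σ K) = ((P.eval (q : ℚ) : ℚ) : K) := by
  set n : MvPowerSeries σ K := (u : MvPowerSeries σ K) - 1 with hn
  -- The binomial expansion of `(u - 1) ^ m` expresses its coefficient through the known values `f
  -- j`.
  set e : ℕ → ℚ := fun m => ∑ j ∈ Finset.range (m + 1), f j * ((-1) ^ (m - j) * m.choose j) with he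
  have hcoeff : ∀ m, MvPowerSeries.coeff k (n ^ m) = e m := by
    intro m
    rw [hn, sub_eq_add_neg, add_pow, map_sum, he]
    push_cast
    refine Finset.sum_congr rfl fun j _ => ?_
    rw [← hf, mul_assoc]
    have : ((-1 : MvPowerSeries σ K) ^ (m - j) * (m.choose j : MvPowerSeries σ K)) =
        MvPowerSeries.C ((-1 : K) ^ (m - j) * (m.choose j : K)) := by simp
    rw [this, MvPowerSeries.coeff_mul_C]
  refine ⟨∑ m ∈ Finset.range (k.degree + 1),
    Polynomial.C (e m / m.factorial) * descPochhammer ℚ m, fun q => ?_⟩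
  obtain ⟨g, hg⟩ := sub_one_pow_dvd_zpow_sub_sum u k.degree q
  have hzero : MvPowerSeries.coeff k (n ^ (k.degree + 1) * g) = 0 := by
    apply MvPowerSeries.coeff_of_lt_order
    have h1 : ((k.degree + 1 : ℕ) : ℕ∞) ≤ (n ^ (k.degree + 1)).order :=
      MvPowerSeries.le_order_pow_of_constantCoeff_eq_zero _ (by rw [hn, map_sub, hu]; simp)
    refine lt_of_lt_of_le ?_ ((h1.trans le_self_add).trans MvPowerSeries.le_order_mul)
    exact_mod_cast Nat.lt_succ_self _
  rw [sub_eq_iff_eq_add.1 hg, map_add, hzero, zero_add, map_sum, eval_finsetSum]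
  push_cast
  refine Finset.sum_congr rfl fun m _ => ?_
  have hC : ((Ring.choose q m : ℤ) : MvPowerSeries σ K) = MvPowerSeries.C ((Ring.choose q m : ℤ) : K) := by
    simp
  rw [hC, MvPowerSeries.coeff_C_mul, hcoeff, eval_mul, eval_C]
  have hd : (descPochhammer ℚ m).eval (q : ℚ) = m.factorial * (Ring.choose q m : ℤ) := by
    have h := Ring.descPochhammer_eq_factorial_smul_choose q m
    rw [← eval_eq_smeval, nsmul_eq_mul] at h
    rw [← descPochhammer_eval_cast, h]
    push_cast
    rfl
  rw [hd]
  have hm : (m.factorial : K) ≠ 0 := by exact_mod_cast m.factorial_ne_zero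
  push_cast
  field_simp

/-! ### The coefficient formula for all integral powers -/

theorem BKMSupermatrix.IsFree.mono {I : Type*} {M : BKMSupermatrix I} {k β : I →₀ ℕ}
    (hk : M.IsFree k) (h : β ≤ k) : M.IsFree β := fun i hi => (h i).trans (hk i hi)

/-- `U` is a well-defined formal power series (every exponent lies in `-Q₊` and occurs finitely
often) which is invertible, and for free `k` and all `q ∈ ℤ` the coefficient of `e^{-η(k)}`
in `U ^ q` is `(-1) ^ ht(η(k))` times the value at `q` of the `k`-chromatic polynomial. -/
theorem mainTheorem7 {I : Type*} [Countable I] (M : BKMSupermatrix I)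
    (ρ : WeightSpace I) (hρ : M.IsWeylVector ρ) :
    (∀ (w : M.weylGroup) (γ : M.Omega), ∃ β : I →₀ ℕ, (w, γ) ∈ M.termsAt ρ β) ∧
    (∀ β : I →₀ ℕ, (M.termsAt ρ β).Finite) ∧
    ∃ u : (MvPowerSeries I ℂ)ˣ, (u : MvPowerSeries I ℂ) = M.U ρ ∧
      ∀ k : I →₀ ℕ, M.IsFree k →
        ∃ P : Polynomial ℚ, IsChromaticPolynomial M.quasiDynkin k P ∧
          ∀ q : ℤ, MvPowerSeries.coeff k ((u ^ q : (MvPowerSeries I ℂ)ˣ) : MvPowerSeries I ℂ) =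
            (-1 : ℂ) ^ BKMSupermatrix.height k * ((P.eval (q : ℚ) : ℚ) : ℂ) := by
  classical
  refine ⟨hρ.exists_mem_termsAt, fun β => (hρ.termsAt_subsingleton β).finite, ?_⟩
  have hU0 : MvPowerSeries.constantCoeff (M.U ρ) = 1 := by
    rw [← MvPowerSeries.coeff_zero_eq_constantCoeff_apply,
      hρ.coeff_U (β := 0) (fun i _ => by simp), if_pos ⟨by simp, by simp⟩]
    simp [BKMSupermatrix.height]
  obtain ⟨u, hu⟩ : IsUnit (M.U ρ) := by
    rw [MvPowerSeries.isUnit_iff_constantCoeff, hU0]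
    exact isUnit_one
  refine ⟨u, hu, fun k hk => ?_⟩
  have hcard := coeff_pow_eq_card_multicoloring (G := M.quasiDynkin) (k := k) (F := M.U ρ)
    fun β hβ => hρ.coeff_U (hk.mono hβ)
  obtain ⟨P, hP⟩ := MvPowerSeries.exists_polynomial_coeff_zpow u (by rw [hu, hU0]) k
    (fun q => (-1) ^ BKMSupermatrix.height k * Nat.card (Multicoloring M.quasiDynkin k q))
    fun q => by rw [hu, hcard]; push_cast; rfl
  have hsq : ∀ {R : Type} [CommRing R], (-1 : R) ^ BKMSupermatrix.height k *
      (-1 : R) ^ BKMSupermatrix.height k = 1 := fun {R} _ => by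
    rw [← mul_pow]; simp
  -- `P` interpolates the signed coefficients; multiplying by the sign, which squares to `1`, gives
  -- the chromatic polynomial.
  refine ⟨C ((-1) ^ BKMSupermatrix.height k) * P, fun q => ?_, fun q => ?_⟩
  · have h := hP q
    rw [zpow_natCast, Units.val_pow_eq_pow_val, hu, hcard] at h
    have h' : P.eval (q : ℚ) = (-1) ^ BKMSupermatrix.height k *
        (Nat.card (Multicoloring M.quasiDynkin k q) : ℚ) := by
      have h2 : (((-1) ^ BKMSupermatrix.height k *
        (Nat.card (Multicoloring M.quasiDynkin k q) : ℚ) : ℚ) : ℂ) =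
          ((P.eval (q : ℚ) : ℚ) : ℂ) := by
        push_cast at h ⊢; exact h
      exact (Rat.cast_injective h2).symm
    rw [eval_mul, eval_C, h', ← mul_assoc, hsq, one_mul]
  · rw [hP, eval_mul, eval_C]
    push_cast
    rw [← mul_assoc, hsq, one_mul]
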